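/- All graphs are finite and simple. A $2$-factor of a graph $G$ is a spanning $2$-regular subgraph of $G$, equivalently a union of pairwise vertex-disjoint cycles of $G$ that together contain every vertex; $\delta(G)$ denotes the minimum degree of $G$. For every integer $k \ge 1$ and every real $\varepsilon > 0$ there exists $N = N(k,\varepsilon)$ such that if $G$ is a Hamiltonian graph on $n \ge N$ vertices with $\delta(G) \ge \varepsilon n$, then $G$ has a $2$-factor consisting of exactly $k$ cycles. In particular, for every fixed $k \ge 1$, if $d_k(n)$ denotes the least integer $d \ge 0$ such that every Hamiltonian graph on $n$ vertices with minimum degree at least $d$ has a $2$-factor consisting of exactly $k$ cycles, then $d_k(n) = o(n)$ as $n \to \infty$. -/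

import Mathlib

/-- A `2`-factor of `G`: a spanning `2`-regular subgraph of `G`. -/
def SimpleGraph.Subgraph.IsTwoFactor {V : Type*} {G : SimpleGraph V} (F : G.Subgraph) : Prop :=
  F.IsSpanning ∧ ∀ v : V, (F.neighborSet v).ncard = 2

/-- A subgraph of `G` is a cycle if it is traced out by a closed walk that is a cycle. -/
def SimpleGraph.Subgraph.IsCycleSubgraph {V : Type*} {G : SimpleGraph V} (C : G.Subgraph) : Prop :=
  ∃ (v : V) (p : G.Walk v v), p.IsCycle ∧ C = p.toSubgraph

/-- The subgraph `F` consists of exactly `k` cycles: it is the union of `k` cycles that are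
pairwise vertex-disjoint. -/
def SimpleGraph.Subgraph.ConsistsOfCycles {V : Type*} {G : SimpleGraph V} (F : G.Subgraph)
    (k : ℕ) : Prop :=
  ∃ C : Fin k → G.Subgraph,
    (∀ i, (C i).IsCycleSubgraph) ∧
    (∀ i j, i ≠ j → Disjoint (C i).verts (C j).verts) ∧
    F = ⨆ i, C i

/-- `G` has a `2`-factor consisting of exactly `k` cycles. -/
def SimpleGraph.HasTwoFactorWithCycles {V : Type*} (G : SimpleGraph V) (k : ℕ) : Prop :=
  ∃ F : G.Subgraph, F.IsTwoFactor ∧ F.ConsistsOfCycles k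

/-- The minimum-degree threshold: the least `d` such that every Hamiltonian graph on `n` vertices
with minimum degree at least `d` has a `2`-factor consisting of exactly `k` cycles. Such a `d`
always exists, because no graph on `n` vertices has minimum degree greater than `n`. -/
noncomputable def twoFactorThreshold (k n : ℕ) : ℕ :=
  sInf {d : ℕ | ∀ (G : SimpleGraph (Fin n)) [DecidableRel G.Adj],
    G.IsHamiltonian → d ≤ G.minDegree → G.HasTwoFactorWithCycles k}

/-! Number the vertices cyclically along a Hamilton cycle and consider two relations of minimum
degree at least εn: adjacency of u, v, and adjacency of their successors u + 1, v + 1. For a large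
constant M, most pairs of M-tuples u, w are such that every entry of u has a neighbour in w for the
first relation and every entry of w has one in u for the second. Pigeonholing over who is matched to
whom (`exists_functions_of_minDegree`) and finding a complete box in a dense set of tuples
(`exists_box`) blows the entries up to large blocks with all these joins complete. The periodic
points of the composed matching function select blocks on which the two matchings become involutions
β and ρ.

After thinning, the blocks occupy disjoint intervals and have no consecutive elements
(`exists_separated_subsets`, `exists_spacedBlocks`). Delete the cycle edge leaving each block
vertex; join the s-th vertex of block i to the s-th of block β i, and the successor of the s-th
vertex of block i to that of block ρ i. The number of block vertices below v, modulo the block size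
t, is constant along the resulting 2-factor and takes all t values, so there are at least t ≥ k
cycles.

The number of cycles is then lowered one at a time. If two vertices of one class lie on different
cycles, crossing over their edges to the partner class merges exactly those two cycles
(`IsLinkedFactor.exists_merge`). When no such pair remains, the factor is connected
(`SpacedBlocks.preconnected`). Hence every count from t down to 1 occurs, in particular k. -/

namespace SimpleGraph

/-! ### Two-factors as 2-regular graphs counted by components -/

variable {V : Type*}

/-- A `2`-regular spanning subgraph with `k` connected components is a `2`-factor with exactly
`k` cycles. -/
theorem hasTwoFactorWithCycles_of_card_connectedComponent [Finite V] {G F : SimpleGraph V} {k : ℕ}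
    (hFG : F ≤ G) (h2 : ∀ v, (F.neighborSet v).ncard = 2)
    (hk : Nat.card F.ConnectedComponent = k) : G.HasTwoFactorWithCycles k := by
  classical
  have : F.LocallyFinite := fun v => Fintype.ofFinite _
  have hcyc : F.IsCycles := fun v _ => h2 v
  have hne : ∀ v, (F.neighborSet v).Nonempty := fun v =>
    Set.nonempty_of_ncard_ne_zero (by rw [h2 v]; norm_num)
  have key : ∀ c : F.ConnectedComponent, ∃ (v : V) (p : F.Walk v v), p.IsCycle ∧
      p.toSubgraph.verts = c.supp := by
    intro c
    obtain ⟨v, hv⟩ := c.nonempty_supp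
    obtain ⟨p, hp⟩ := hcyc.exists_cycle_toSubgraph_verts_eq_connectedComponentSupp hv (hne v)
    exact ⟨v, p, hp⟩
  choose x p hp hps using key
  have hadj : ∀ c u w, (p c).toSubgraph.Adj u w ↔ u ∈ c.supp ∧ F.Adj u w := by
    intro c u w
    constructor
    · intro h
      exact ⟨hps c ▸ h.fst_mem, h.adj_sub⟩
    · rintro ⟨hu, h⟩
      rwa [(hp c).adj_toSubgraph_iff_of_isCycles hcyc (by rw [hps c]; exact hu)]
  have e : Fin k ≃ F.ConnectedComponent := (Finite.equivFinOfCardEq hk).symm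
  let C : Fin k → G.Subgraph := fun i => ((p (e i)).mapLe hFG).toSubgraph
  have hCv : ∀ i, (C i).verts = (e i).supp := by
    intro i
    rw [← hps]
    ext v
    simp [C, Walk.mapLe]
  have hCadj : ∀ i u w, (C i).Adj u w ↔ u ∈ (e i).supp ∧ F.Adj u w := by
    intro i u w
    rw [← hadj]
    rw [← Subgraph.mem_edgeSet, ← Subgraph.mem_edgeSet, Walk.mem_edges_toSubgraph,
      Walk.mem_edges_toSubgraph]
    simp [Walk.mapLe]
  refine ⟨⨆ i, C i, ⟨?_, ?_⟩, C, ?_, ?_, rfl⟩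
  · intro v
    rw [Subgraph.verts_iSup, Set.mem_iUnion]
    refine ⟨e.symm (F.connectedComponentMk v), ?_⟩
    rw [hCv]
    simp
  · intro v
    rw [← h2 v]
    congr 1
    ext w
    simp only [Subgraph.mem_neighborSet, Subgraph.iSup_adj, hCadj, mem_neighborSet]
    constructor
    · rintro ⟨i, -, h⟩
      exact h
    · intro h
      exact ⟨e.symm (F.connectedComponentMk v), by simp, h⟩
  · intro i
    exact ⟨_, (p (e i)).mapLe hFG, (hp _).mapLe hFG, rfl⟩
  · intro i j hij
    rw [hCv, hCv]
    exact pairwise_disjoint_supp_connectedComponent F (fun h => hij (e.injective h))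

theorem HasTwoFactorWithCycles.of_iso_card {W : Type*} [Finite V] [Finite W] {G : SimpleGraph V}
    (e : W ≃ V) {F : SimpleGraph W} {k : ℕ} (hFG : ∀ u v, F.Adj u v → G.Adj (e u) (e v))
    (h2 : ∀ v, (F.neighborSet v).ncard = 2)
    (hk : Nat.card F.ConnectedComponent = k) : G.HasTwoFactorWithCycles k := by
  let φ : F ≃g F.map e.toEmbedding := Iso.map e F
  refine hasTwoFactorWithCycles_of_card_connectedComponent (F := F.map e.toEmbedding) ?_ ?_ ?_
  · rw [map_le_iff_le_comap]
    exact fun u v h => hFG u v h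
  · intro v
    obtain ⟨u, rfl⟩ := φ.surjective v
    rw [← h2 u]
    exact (Nat.card_congr (φ.mapNeighborSet u)).symm
  · rw [← hk]
    exact (Nat.card_congr φ.connectedComponentEquiv).symm

/-! ### Edge swaps in 2-regular graphs -/

/-- Replace the edges `pq` and `p'q'` by the edges `pq'` and `p'q`. -/
def swapEdges (F : SimpleGraph V) (p q p' q' : V) : SimpleGraph V :=
  F.deleteEdges {s(p, q), s(p', q')} ⊔ (edge p q' ⊔ edge p' q)

theorem swapEdges_adj {F : SimpleGraph V} {p q p' q' u v : V} (h : p ≠ q') (h' : p' ≠ q) :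
    (F.swapEdges p q p' q').Adj u v ↔
      (F.Adj u v ∧ s(u, v) ≠ s(p, q) ∧ s(u, v) ≠ s(p', q')) ∨
        s(u, v) = s(p, q') ∨ s(u, v) = s(p', q) := by
  simp only [swapEdges, sup_adj, deleteEdges_adj, edge_adj, Set.mem_insert_iff,
    Set.mem_singleton_iff, Sym2.eq_iff]
  grind

theorem swapEdges_comm (F : SimpleGraph V) (p q p' q' : V) :
    F.swapEdges p q p' q' = F.swapEdges q p q' p' := by
  simp only [swapEdges, Sym2.eq_swap (a := p), Sym2.eq_swap (a := p'), edge_comm p, edge_comm p']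
  rw [sup_comm (edge q' p)]

theorem swapEdges_comm' (F : SimpleGraph V) (p q p' q' : V) :
    F.swapEdges p q p' q' = F.swapEdges p' q' p q := by
  simp only [swapEdges]
  rw [sup_comm (edge p q'), Set.pair_comm]

section Swap

variable {F : SimpleGraph V} {p q p' q' : V}

theorem ncard_neighborSet_swapEdges_left (hpq : F.Adj p q) (hpq' : F.Adj p' q')
    (hr : ¬ F.Reachable p p') (h2 : (F.neighborSet p).ncard = 2) :
    ((F.swapEdges p q p' q').neighborSet p).ncard = 2 := by
  have hpp' : p ≠ p' := fun h => hr (h ▸ Reachable.refl _)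
  have hpq'n : ¬ F.Reachable p q' := fun h => hr (h.trans hpq'.symm.reachable)
  have h1 : p ≠ q' := fun h => hpq'n (h ▸ Reachable.refl _)
  have h3 : p' ≠ q := fun h => hr (h ▸ hpq.reachable)
  have h4 : p ≠ q := hpq.ne
  have : (F.swapEdges p q p' q').neighborSet p = insert q' (F.neighborSet p \ {q}) := by
    ext v
    simp only [mem_neighborSet, swapEdges_adj h1 h3, Set.mem_insert_iff, Set.mem_sdiff,
      Set.mem_singleton_iff, Sym2.eq_iff]
    grind
  have hfin : (F.neighborSet p).Finite := Set.finite_of_ncard_ne_zero (by rw [h2]; norm_num)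
  rw [this, Set.ncard_insert_of_notMem (fun h => hpq'n (Adj.reachable h.1)) (hfin.subset
    Set.sdiff_subset),
      Set.ncard_sdiff_singleton_of_mem ((F.mem_neighborSet p q).2 hpq), h2]

theorem ncard_neighborSet_swapEdges (hpq : F.Adj p q) (hpq' : F.Adj p' q')
    (hr : ¬ F.Reachable p p') (h2 : ∀ v, (F.neighborSet v).ncard = 2) (v : V) :
    ((F.swapEdges p q p' q').neighborSet v).ncard = 2 := by
  have hrq : ¬ F.Reachable q q' := fun h =>
    hr (hpq.reachable.trans (h.trans hpq'.symm.reachable))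
  by_cases hp : v = p
  · subst hp
    exact ncard_neighborSet_swapEdges_left hpq hpq' hr (h2 _)
  by_cases hp' : v = p'
  · subst hp'
    rw [swapEdges_comm']
    exact ncard_neighborSet_swapEdges_left hpq' hpq (fun h => hr h.symm) (h2 _)
  by_cases hq : v = q
  · subst hq
    rw [swapEdges_comm]
    exact ncard_neighborSet_swapEdges_left hpq.symm hpq'.symm hrq (h2 _)
  by_cases hq' : v = q'
  · subst hq'
    rw [swapEdges_comm, swapEdges_comm']
    exact ncard_neighborSet_swapEdges_left hpq'.symm hpq.symm (fun h => hrq h.symm) (h2 _)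
  rw [← h2 v]
  congr 1
  ext w
  have h1 : p ≠ q' := fun h => hr (by rw [h]; exact hpq'.symm.reachable)
  have h3 : p' ≠ q := fun h => hr (by rw [h]; exact hpq.reachable)
  simp only [mem_neighborSet, swapEdges_adj h1 h3, Sym2.eq_iff]
  grind

/-- An edge on a cycle is not a bridge, and the detour from `p` to `q` stays in its own component,
so removing `p'q'` does not break it. -/
theorem reachable_swapEdges_of_adj [Finite V] (hpq : F.Adj p q) (hpq' : F.Adj p' q')
    (hr : ¬ F.Reachable p p') (h2 : ∀ v, (F.neighborSet v).ncard = 2) :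
    (F.swapEdges p q p' q').Reachable p q := by
  have hcyc : F.IsCycles := fun v _ => h2 v
  have h1 : p ≠ q' := fun h => hr (by rw [h]; exact hpq'.symm.reachable)
  have h3 : p' ≠ q := fun h => hr (by rw [h]; exact hpq.reachable)
  have aux : ∀ {u w : V} (r : (F.deleteEdges {s(p, q)}).Walk u w), F.Reachable p u →
      (F.swapEdges p q p' q').Reachable u w := by
    intro u w r
    induction r with
    | nil => exact fun _ => Reachable.refl _
    | @cons u v w h r ih =>
      intro hu
      rw [deleteEdges_adj, Set.mem_singleton_iff] at h
      refine Reachable.trans (Adj.reachable ?_) (ih (hu.trans h.1.reachable))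
      rw [swapEdges_adj h1 h3]
      refine Or.inl ⟨h.1, h.2, fun he => ?_⟩
      rw [Sym2.eq_iff] at he
      rcases he with ⟨rfl, rfl⟩ | ⟨rfl, rfl⟩
      · exact hr hu
      · exact hr (hu.trans hpq'.symm.reachable)
  obtain ⟨r⟩ := hcyc.reachable_deleteEdges hpq
  exact aux r (Reachable.refl _)

theorem Reachable.swapEdges [Finite V] (hpq : F.Adj p q) (hpq' : F.Adj p' q')
    (hr : ¬ F.Reachable p p') (h2 : ∀ v, (F.neighborSet v).ncard = 2) {u v : V}
    (huv : F.Reachable u v) : (F.swapEdges p q p' q').Reachable u v := by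
  have h1 : p ≠ q' := fun h => hr (by rw [h]; exact hpq'.symm.reachable)
  have h3 : p' ≠ q := fun h => hr (by rw [h]; exact hpq.reachable)
  have hp := reachable_swapEdges_of_adj hpq hpq' hr h2
  have hp' := reachable_swapEdges_of_adj hpq' hpq (fun h => hr h.symm) h2
  rw [swapEdges_comm'] at hp'
  obtain ⟨r⟩ := huv
  induction r with
  | nil => exact Reachable.refl _
  | @cons u v w h r ih =>
    refine Reachable.trans ?_ ih
    by_cases he : s(u, v) = s(p, q)
    · rw [Sym2.eq_iff] at he
      rcases he with ⟨rfl, rfl⟩ | ⟨rfl, rfl⟩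
      exacts [hp, hp.symm]
    by_cases he' : s(u, v) = s(p', q')
    · rw [Sym2.eq_iff] at he'
      rcases he' with ⟨rfl, rfl⟩ | ⟨rfl, rfl⟩
      exacts [hp', hp'.symm]
    exact ((swapEdges_adj h1 h3).2 (Or.inl ⟨h, he, he'⟩)).reachable

/-- Each new edge joins the component of `p` to that of `p'`, so no other components can be
identified. -/
theorem reachable_of_swapEdges (hpq : F.Adj p q) (hpq' : F.Adj p' q')
    (hr : ¬ F.Reachable p p') {u v : V} (huv : (F.swapEdges p q p' q').Reachable u v) :
    F.Reachable u v ∨ (F.Reachable p u ∧ F.Reachable p' v) ∨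
      (F.Reachable p' u ∧ F.Reachable p v) := by
  have h1 : p ≠ q' := fun h => hr (by rw [h]; exact hpq'.symm.reachable)
  have h3 : p' ≠ q := fun h => hr (by rw [h]; exact hpq.reachable)
  have hq := hpq.reachable
  have hq' := hpq'.reachable
  obtain ⟨r⟩ := huv
  induction r with
  | nil => exact Or.inl (Reachable.refl _)
  | @cons u v w h r ih =>
    rw [swapEdges_adj h1 h3, Sym2.eq_iff, Sym2.eq_iff] at h
    rcases h with ⟨h, -, -⟩ | (⟨rfl, rfl⟩ | ⟨rfl, rfl⟩) | (⟨rfl, rfl⟩ | ⟨rfl, rfl⟩)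
    · have := h.reachable
      rcases ih with ih | ⟨ih, ih'⟩ | ⟨ih, ih'⟩
      · exact Or.inl (this.trans ih)
      · exact Or.inr (Or.inl ⟨ih.trans this.symm, ih'⟩)
      · exact Or.inr (Or.inr ⟨ih.trans this.symm, ih'⟩)
    · rcases ih with ih | ⟨ih, ih'⟩ | ⟨ih, ih'⟩
      · exact Or.inr (Or.inl ⟨Reachable.refl _, hq'.trans ih⟩)
      · exact absurd (ih.trans hq'.symm) hr
      · exact Or.inl ih'
    · rcases ih with ih | ⟨ih, ih'⟩ | ⟨ih, ih'⟩
      · exact Or.inr (Or.inr ⟨hq', ih⟩)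
      · exact Or.inl (hq'.symm.trans ih')
      · exact absurd ih.symm hr
    · rcases ih with ih | ⟨ih, ih'⟩ | ⟨ih, ih'⟩
      · exact Or.inr (Or.inr ⟨Reachable.refl _, hq.trans ih⟩)
      · exact Or.inl ih'
      · exact absurd (hq.trans ih.symm) hr
    · rcases ih with ih | ⟨ih, ih'⟩ | ⟨ih, ih'⟩
      · exact Or.inr (Or.inl ⟨hq, ih⟩)
      · exact absurd ih hr
      · exact Or.inl (hq.symm.trans ih')

/-- Swapping two edges in different components of a `2`-regular graph merges these components. -/
theorem card_connectedComponent_swapEdges [Finite V] (hpq : F.Adj p q) (hpq' : F.Adj p' q')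
    (hr : ¬ F.Reachable p p') (h2 : ∀ v, (F.neighborSet v).ncard = 2) :
    Nat.card (F.swapEdges p q p' q').ConnectedComponent + 1 = Nat.card F.ConnectedComponent := by
  classical
  set F' := F.swapEdges p q p' q' with hF'
  have h1 : p ≠ q' := fun h => hr (by rw [h]; exact hpq'.symm.reachable)
  have h3 : p' ≠ q := fun h => hr (by rw [h]; exact hpq.reachable)
  have up : ∀ {u v}, F.Reachable u v → F'.Reachable u v :=
    fun h => h.swapEdges hpq hpq' hr h2
  let π : F.ConnectedComponent → F'.ConnectedComponent :=
    ConnectedComponent.lift F'.connectedComponentMk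
      (fun u v r _ => ConnectedComponent.sound (up r.reachable))
  have hπ : ∀ v, π (F.connectedComponentMk v) = F'.connectedComponentMk v := fun v => rfl
  have hpp' : F'.Reachable p p' :=
    (Adj.reachable ((swapEdges_adj h1 h3).2 (Or.inr (Or.inl rfl)))).trans
      (up hpq'.symm.reachable)
  -- `π` identifies the components of `p` and `p'` and nothing else, so it becomes a bijection once
  -- the latter is dropped.
  have : Nat.card {c : F.ConnectedComponent // c ≠ F.connectedComponentMk p'} + 1 =
      Nat.card F.ConnectedComponent := by
    have := Fintype.ofFinite F.ConnectedComponent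
    rw [Nat.card_eq_fintype_card, Nat.card_eq_fintype_card, Fintype.card_subtype_compl]
    have := Fintype.card_pos_iff.2 ⟨F.connectedComponentMk p'⟩
    simp only [Fintype.card_unique]
    omega
  rw [← this]
  congr 1
  symm
  refine Nat.card_congr (Equiv.ofBijective (fun c => π c.1) ⟨?_, ?_⟩)
  · rintro ⟨c, hc⟩ ⟨d, hd⟩ h
    induction c using ConnectedComponent.ind with | _ u
    induction d using ConnectedComponent.ind with | _ v
    simp only [hπ, ConnectedComponent.eq, ne_eq] at h hc hd
    simp only [Subtype.mk.injEq, ConnectedComponent.eq]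
    rcases reachable_of_swapEdges hpq hpq' hr h with h | h | h
    · exact h
    · exact absurd h.2.symm hd
    · exact absurd h.1.symm hc
  · intro c
    induction c using ConnectedComponent.ind with | _ u
    by_cases hu : F.Reachable u p'
    · refine ⟨⟨F.connectedComponentMk p, fun h => hr (ConnectedComponent.exact h)⟩, ?_⟩
      simp only [hπ, ConnectedComponent.eq]
      exact hpp'.trans (up hu.symm)
    · exact ⟨⟨F.connectedComponentMk u, fun h => hu (ConnectedComponent.exact h)⟩, hπ u⟩

end Swap

/-! ### Linked factors and merging their cycles -/

/-- `F` is a `2`-factor of `G` which contains the graph `L` and in which every vertex `z i s` of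
the class `i` has a neighbour in the class `τ i`. -/
structure IsLinkedFactor {I T : Type*} (G L : SimpleGraph V) (τ : I → I) (z : I × T → V)
    (F : SimpleGraph V) : Prop where
  le : F ≤ G
  ncard_neighborSet : ∀ v, (F.neighborSet v).ncard = 2
  base_le : L ≤ F
  exists_adj : ∀ i s, ∃ s', F.Adj (z (i, s)) (z (τ i, s'))

section Merge

variable {I T : Type*} {G L : SimpleGraph V} {τ : I → I} {z : I × T → V} {F : SimpleGraph V}

/-- Exchange the partners of the two separated vertices. Completeness between the classes `i` and `τ
i` puts the new edges in `G`. No edge of `L` runs between these classes, so `L` survives, and all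
four endpoints keep a neighbour in the partner class, so the step can be repeated. -/
theorem IsLinkedFactor.exists_merge [Finite V] (hτ : ∀ i, τ (τ i) = i)
    (hz : Function.Injective z) (hG : ∀ i s s', G.Adj (z (i, s)) (z (τ i, s')))
    (hL : ∀ i s s', ¬ L.Adj (z (i, s)) (z (τ i, s')))
    (hF : IsLinkedFactor G L τ z F) {i : I} {s s' : T}
    (hs : ¬ F.Reachable (z (i, s)) (z (i, s'))) :
    ∃ F', IsLinkedFactor G L τ z F' ∧
      Nat.card F'.ConnectedComponent + 1 = Nat.card F.ConnectedComponent := by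
  obtain ⟨r, hr⟩ := hF.exists_adj i s
  obtain ⟨r', hr'⟩ := hF.exists_adj i s'
  have h1 : z (i, s) ≠ z (τ i, r') := fun h => hs (by rw [h]; exact hr'.symm.reachable)
  have h3 : z (i, s') ≠ z (τ i, r) := fun h => hs (by rw [h]; exact hr.reachable)
  refine ⟨F.swapEdges (z (i, s)) (z (τ i, r)) (z (i, s')) (z (τ i, r')), ⟨?_, ?_, ?_, ?_⟩,
    card_connectedComponent_swapEdges hr hr' hs hF.ncard_neighborSet⟩
  · intro u v h
    rw [swapEdges_adj h1 h3, Sym2.eq_iff, Sym2.eq_iff] at h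
    rcases h with ⟨h, -, -⟩ | (⟨rfl, rfl⟩ | ⟨rfl, rfl⟩) | (⟨rfl, rfl⟩ | ⟨rfl, rfl⟩)
    · exact hF.le h
    · exact hG _ _ _
    · exact (hG _ _ _).symm
    · exact hG _ _ _
    · exact (hG _ _ _).symm
  · exact ncard_neighborSet_swapEdges hr hr' hs hF.ncard_neighborSet
  · intro u v h
    rw [swapEdges_adj h1 h3]
    refine Or.inl ⟨hF.base_le h, fun he => ?_, fun he => ?_⟩ <;>
    · rw [Sym2.eq_iff] at he
      rcases he with ⟨rfl, rfl⟩ | ⟨rfl, rfl⟩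
      · exact hL _ _ _ h
      · exact hL _ _ _ h.symm
  · intro j t
    obtain ⟨t', ht'⟩ := hF.exists_adj j t
    simp only [swapEdges_adj h1 h3, Sym2.eq_iff, ne_eq, hz.eq_iff, Prod.mk.injEq]
    by_cases hj : j = i
    · subst hj
      by_cases h : t = s
      · exact ⟨r', Or.inr (Or.inl (Or.inl (by simp [h])))⟩
      by_cases h' : t = s'
      · exact ⟨r, Or.inr (Or.inr (Or.inl (by simp [h'])))⟩
      -- If `τ` fixes the class, all four endpoints of the swapped edges lie in it.
      by_cases hjj : τ j = j
      · by_cases h4 : t = r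
        · exact ⟨s', Or.inr (Or.inr (Or.inr (by simp [h4, hjj])))⟩
        by_cases h5 : t = r'
        · exact ⟨s, Or.inr (Or.inl (Or.inr (by simp [h5, hjj])))⟩
        exact ⟨t', Or.inl ⟨ht', by simp [h, h4], by simp [h', h5]⟩⟩
      · exact ⟨t', Or.inl ⟨ht', by grind, by grind⟩⟩
    · by_cases hj' : j = τ i
      · subst hj'
        by_cases h4 : t = r
        · exact ⟨s', Or.inr (Or.inr (Or.inr (by simp [h4, hτ])))⟩
        by_cases h5 : t = r'
        · exact ⟨s, Or.inr (Or.inl (Or.inr (by simp [h5, hτ])))⟩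
        exact ⟨t', Or.inl ⟨ht', by grind, by grind⟩⟩
      · exact ⟨t', Or.inl ⟨ht', by grind, by grind⟩⟩

/-- If linked factors that are connected within all classes are connected, then the number of
components of a linked factor can be lowered to any positive number. -/
theorem IsLinkedFactor.exists_card_eq [Finite V] (hτ : ∀ i, τ (τ i) = i)
    (hz : Function.Injective z) (hG : ∀ i s s', G.Adj (z (i, s)) (z (τ i, s')))
    (hL : ∀ i s s', ¬ L.Adj (z (i, s)) (z (τ i, s')))
    (hconn : ∀ F, L ≤ F → (∀ i s s', F.Reachable (z (i, s)) (z (i, s'))) → F.Preconnected)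
    {k : ℕ} (hk : 1 ≤ k) (hF : IsLinkedFactor G L τ z F)
    (hc : k ≤ Nat.card F.ConnectedComponent) :
    ∃ F', IsLinkedFactor G L τ z F' ∧ Nat.card F'.ConnectedComponent = k := by
  induction hm : Nat.card F.ConnectedComponent using Nat.strong_induction_on generalizing F with
  | _ m ih =>
    subst hm
    by_cases h : Nat.card F.ConnectedComponent = k
    · exact ⟨F, hF, h⟩
    by_cases hall : ∀ i s s', F.Reachable (z (i, s)) (z (i, s'))
    · have := (hconn F hF.base_le hall).subsingleton_connectedComponent
      have := Finite.card_le_one_iff_subsingleton.2 this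
      omega
    · push Not at hall
      obtain ⟨i, s, s', hs⟩ := hall
      obtain ⟨F', hF', hcard⟩ := hF.exists_merge hτ hz hG hL hs
      exact ih _ (by omega) hF' (by omega) rfl

end Merge

end SimpleGraph

/-! ### Spaced blocks and the label modulo the block size -/

theorem Fin.val_add_one_of_val_lt {n : ℕ} [NeZero n] {v : Fin n} (h : v.val + 1 < n) :
    (v + 1).val = v.val + 1 := by
  rw [Fin.val_add, Fin.coe_ofNat_eq_mod, Nat.add_mod_mod, Nat.mod_eq_of_lt h]

theorem Fin.add_one_eq_zero_of_val {n : ℕ} [NeZero n] {v : Fin n} (h : ¬ v.val + 1 < n) :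
    v + 1 = 0 := by
  apply Fin.ext
  rw [Fin.val_add, Fin.coe_ofNat_eq_mod, Nat.add_mod_mod, show v.val + 1 = n by omega]
  simp

/-- A system of blocks `a (i, 0) < a (i, 1) < ⋯` in `Fin n`, pairwise separated and without
consecutive elements. -/
structure SpacedBlocks {I : Type*} {t n : ℕ} (a : I × Fin t → Fin n) : Prop where
  strictMono : ∀ i, StrictMono fun s => a (i, s)
  separated : ∀ i j, i ≠ j →
    (∀ s s', a (i, s) < a (j, s')) ∨ (∀ s s', a (j, s') < a (i, s))
  spaced : ∀ x y, a x < a y → (a x).val + 1 < (a y).val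
  lt_last : ∀ x, (a x).val + 1 < n

namespace SpacedBlocks

variable {I : Type*} {t n : ℕ} {a : I × Fin t → Fin n}

theorem injective (h : SpacedBlocks a) : Function.Injective a := by
  rintro ⟨i, s⟩ ⟨j, s'⟩ hij
  by_cases hne : i = j
  · subst hne
    rw [(h.strictMono i).injective hij]
  · rcases h.separated i j hne with h' | h'
    · exact absurd hij (h' s s').ne
    · exact absurd hij (h' s s').ne'

/-- The number of block elements below `v`, modulo the block size. -/
def label [Fintype I] (a : I × Fin t → Fin n) (v : Fin n) : ZMod t :=
  ∑ i, ∑ s, if a (i, s) < v then 1 else 0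

/-- Every other block lies entirely below or entirely above, contributing `t` or `0`, both zero in
`ZMod t`; only the position within the vertex's own block counts. -/
theorem label_apply [Fintype I] (h : SpacedBlocks a) (i : I) (s : Fin t) :
    label a (a (i, s)) = (s.val : ZMod t) := by
  classical
  have : ∀ j, (∑ s', if a (j, s') < a (i, s) then (1 : ZMod t) else 0) =
      if j = i then (s.val : ZMod t) else 0 := by
    intro j
    split_ifs with hj
    · subst hj
      simp only [(h.strictMono j).lt_iff_lt]
      rw [Finset.sum_boole]
      congr 1
      rw [Finset.filter_gt_eq_Iio]
      simp
    · rcases h.separated i j (fun h => hj h.symm) with h' | h'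
      · simp [fun s' => (h' s s').not_gt]
      · simp [fun s' => h' s s']
  rw [label, Finset.sum_congr rfl fun j _ => this j]
  simp

variable [NeZero n]

theorem val_add_one (h : SpacedBlocks a) (x : I × Fin t) : (a x + 1).val = (a x).val + 1 :=
  Fin.val_add_one_of_val_lt (h.lt_last x)

theorem add_one_ne (h : SpacedBlocks a) (x y : I × Fin t) : a x + 1 ≠ a y := by
  intro he
  have h1 := h.val_add_one x
  rw [he] at h1
  have := h.spaced x y (by rw [Fin.lt_def]; omega)
  omega

theorem label_add_one_of_mem [Fintype I] (h : SpacedBlocks a) (i : I) (s : Fin t) :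
    label a (a (i, s) + 1) = (s.val : ZMod t) + 1 := by
  classical
  rw [← h.label_apply i s, label, label, ← Fintype.sum_prod_type', ← Fintype.sum_prod_type']
  have : ∀ x : I × Fin t, (if a (x.1, x.2) < a (i, s) + 1 then (1 : ZMod t) else 0) =
      (if a (x.1, x.2) < a (i, s) then 1 else 0) + if x = (i, s) then 1 else 0 := by
    intro x
    have h1 := h.val_add_one (i, s)
    have h2 : a x = a (i, s) ↔ x = (i, s) := h.injective.eq_iff
    simp only [← h2]
    simp only [Fin.lt_def, Fin.ext_iff, h1, Prod.mk.eta]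
    split_ifs <;> first | omega | simp
  rw [Finset.sum_congr rfl fun x _ => this x, Finset.sum_add_distrib]
  simp

theorem label_add_one_of_notMem [Fintype I] {v : Fin n} (hv : ∀ x, a x ≠ v) :
    label a (v + 1) = label a v := by
  by_cases hn : v.val + 1 < n
  · rw [label, label]
    refine Finset.sum_congr rfl fun i _ => Finset.sum_congr rfl fun s _ => ?_
    have h1 := Fin.val_add_one_of_val_lt hn
    have h2 := hv (i, s)
    simp only [Fin.lt_def, Fin.ext_iff, h1, ne_eq] at h2 ⊢
    split_ifs <;> first | omega | rfl
  · rw [Fin.add_one_eq_zero_of_val hn, label, label]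
    -- At the wrap-around from `n - 1` to `0` all blocks lie below `v`, and their total size is a
    -- multiple of `t`.
    have : ∀ i s, a (i, s) < v := by
      intro i s
      have h2 := hv (i, s)
      simp only [Fin.lt_def, Fin.ext_iff, ne_eq] at h2 ⊢
      omega
    simp [this]

/-- The graph of all edges `v, v + 1` with `v` not in a block. -/
def baseGraph (a : I × Fin t → Fin n) : SimpleGraph (Fin n) :=
  SimpleGraph.fromRel fun u v => (∀ x, a x ≠ u) ∧ v = u + 1

theorem reachable_of_forall_notMem {F : SimpleGraph (Fin n)}
    (hF : baseGraph a ≤ F) {u v : Fin n} (huv : u ≤ v) (h : ∀ x, u ≤ a x → ¬ a x < v) :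
    F.Reachable u v := by
  obtain ⟨u, hu⟩ := u
  obtain ⟨v, hv⟩ := v
  obtain ⟨m, rfl⟩ := Nat.exists_eq_add_of_le (show u ≤ v from huv)
  clear huv
  induction m with
  | zero => rfl
  | succ m ih =>
    refine (ih (by omega) fun x hx hx' => h x hx ?_).trans (SimpleGraph.Adj.reachable (hF ?_))
    · rw [Fin.lt_def] at hx' ⊢
      simp only at hx' ⊢
      omega
    · rw [baseGraph, SimpleGraph.fromRel_adj]
      refine ⟨by simp [Fin.ext_iff], Or.inl ⟨fun x hx => h x ?_ ?_, ?_⟩⟩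
      · rw [hx, Fin.le_def]
        simp
      · rw [hx, Fin.lt_def]
        simp
      · apply Fin.ext
        rw [Fin.val_add_one_of_val_lt]
        · rfl
        · exact hv

/-- It suffices to link `v` to `v + 1` for a block vertex `v`, the other cycle edges being linked by
the base graph. The stretch of cycle between the first two elements of the block of `v` contains no
other block vertex, so it links the class of that block to the class of its successors. -/
theorem preconnected (h : SpacedBlocks a) (ht : 2 ≤ t) {F : SimpleGraph (Fin n)}
    (hF : baseGraph a ≤ F) (h0 : ∀ i s s', F.Reachable (a (i, s)) (a (i, s')))
    (h1 : ∀ i s s', F.Reachable (a (i, s) + 1) (a (i, s') + 1)) : F.Preconnected := by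
  have hstep : ∀ v, F.Reachable v (v + 1) := by
    intro v
    by_cases hv : ∀ x, a x ≠ v
    · by_cases hv1 : v = v + 1
      · rw [← hv1]
      · exact SimpleGraph.Adj.reachable
          (hF ((SimpleGraph.fromRel_adj _ _ _).2 ⟨hv1, Or.inl ⟨hv, rfl⟩⟩))
    · push Not at hv
      obtain ⟨⟨i, s⟩, rfl⟩ := hv
      let s0 : Fin t := ⟨0, by omega⟩
      let s1 : Fin t := ⟨1, by omega⟩
      have h01 : a (i, s0) < a (i, s1) := h.strictMono i (by simp [s0, s1, Fin.lt_def])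
      refine (h0 i s s1).trans (SimpleGraph.Reachable.trans (SimpleGraph.Reachable.symm ?_)
        (h1 i s0 s))
      have hv1 := h.val_add_one (i, s0)
      refine reachable_of_forall_notMem hF ?_ ?_
      · rw [Fin.le_def, hv1]
        exact h01
      · rintro ⟨j, r⟩ hx hx'
        rw [Fin.le_def, hv1] at hx
        have hx : a (i, s0) < a (j, r) := hx
        by_cases hij : i = j
        · subst hij
          rw [(h.strictMono i).lt_iff_lt, Fin.lt_def] at hx hx'
          simp only [s0, s1] at hx hx'
          omega
        · rcases h.separated i j hij with h' | h'
          · exact absurd (h' s1 r) hx'.asymm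
          · exact absurd (h' s0 r) hx.asymm
  have hall : ∀ m (hm : m < n), F.Reachable 0 ⟨m, hm⟩ := by
    intro m
    induction m with
    | zero => exact fun _ => SimpleGraph.Reachable.refl _
    | succ m ih =>
      intro hm
      have := (ih (by omega)).trans (hstep _)
      convert this using 1
      apply Fin.ext
      rw [Fin.val_add_one_of_val_lt]
      exact hm
  exact fun u v => (hall _ u.2).symm.trans (hall _ v.2)

/-! ### The ladder factor -/

section Ladder

variable {β ρ : I → I} {G : SimpleGraph (Fin n)}

/-- The neighbour following `v` in the ladder graph. -/
noncomputable def next (a : I × Fin t → Fin n) (β : I → I) : Fin n → Fin n :=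
  Function.extend a (fun x => a (β x.1, x.2)) (fun v => v + 1)

/-- The neighbour preceding `v` in the ladder graph. -/
noncomputable def prev (a : I × Fin t → Fin n) (ρ : I → I) : Fin n → Fin n :=
  Function.extend (fun x => a x + 1) (fun x => a (ρ x.1, x.2) + 1) (fun v => v - 1)

theorem next_apply (h : SpacedBlocks a) (i : I) (s : Fin t) :
    next a β (a (i, s)) = a (β i, s) :=
  h.injective.extend_apply _ _ (i, s)

theorem next_of_notMem {v : Fin n} (hv : ∀ x, a x ≠ v) : next a β v = v + 1 :=
  Function.extend_apply' _ _ _ (fun ⟨x, hx⟩ => hv x hx)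

theorem prev_apply (h : SpacedBlocks a) (i : I) (s : Fin t) :
    prev a ρ (a (i, s) + 1) = a (ρ i, s) + 1 :=
  Function.Injective.extend_apply (f := fun x => a x + 1)
    (fun _ _ hxy => h.injective (add_right_cancel hxy)) _ _ (i, s)

theorem prev_of_notMem {v : Fin n} (hv : ∀ x, a x + 1 ≠ v) : prev a ρ v = v - 1 :=
  Function.extend_apply' _ _ _ (fun ⟨x, hx⟩ => hv x hx)

/-- With `prev_cases`, this makes the ladder adjacency symmetric: edges inside β-pairs are `next` at
both ends, while remaining cycle edges are `next` at one end and `prev` at the other. -/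
theorem next_cases (h : SpacedBlocks a) (hβ : ∀ i, β (β i) = i) (v : Fin n) :
    next a β (next a β v) = v ∨ prev a ρ (next a β v) = v := by
  by_cases hv : ∀ x, a x ≠ v
  · right
    rw [next_of_notMem hv, prev_of_notMem, add_sub_cancel_right]
    exact fun x hx => hv x (add_right_cancel hx)
  · push Not at hv
    obtain ⟨⟨i, s⟩, rfl⟩ := hv
    left
    rw [h.next_apply, h.next_apply, hβ]

theorem prev_cases (h : SpacedBlocks a) (hρ : ∀ i, ρ (ρ i) = i) (v : Fin n) :
    next a β (prev a ρ v) = v ∨ prev a ρ (prev a ρ v) = v := by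
  by_cases hv : ∀ x, a x + 1 ≠ v
  · left
    rw [prev_of_notMem hv, next_of_notMem, sub_add_cancel]
    exact fun x hx => hv x (by rw [hx, sub_add_cancel])
  · push Not at hv
    obtain ⟨⟨i, s⟩, rfl⟩ := hv
    right
    rw [h.prev_apply, h.prev_apply, hρ]

/-- The `2`-regular graph obtained from the cycle `0, 1, …, n - 1` by replacing every edge
`a x, a x + 1` with an edge joining `a x` to its partner under `β`
and an edge joining `a x + 1` to its partner under `ρ`. -/
def ladder (h : SpacedBlocks a) (hβ : ∀ i, β (β i) = i) (hρ : ∀ i, ρ (ρ i) = i)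
    (hnext : ∀ v, next a β v ≠ v) (hprev : ∀ v, prev a ρ v ≠ v) : SimpleGraph (Fin n) where
  Adj u v := v = next a β u ∨ v = prev a ρ u
  symm := ⟨by
    rintro u v (rfl | rfl)
    · exact (h.next_cases hβ u).imp Eq.symm Eq.symm
    · exact (h.prev_cases hρ u).imp Eq.symm Eq.symm⟩
  loopless := ⟨by
    rintro u (hu | hu)
    · exact hnext u hu.symm
    · exact hprev u hu.symm⟩

theorem adj_next (h : SpacedBlocks a) (hH : ∀ v, G.Adj v (v + 1))
    (hB : ∀ i s s', G.Adj (a (i, s)) (a (β i, s'))) (v : Fin n) : G.Adj v (next a β v) := by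
  by_cases hv : ∀ x, a x ≠ v
  · rw [next_of_notMem hv]
    exact hH v
  · push Not at hv
    obtain ⟨⟨i, s⟩, rfl⟩ := hv
    rw [h.next_apply]
    exact hB i s s

theorem adj_prev (h : SpacedBlocks a) (hH : ∀ v, G.Adj v (v + 1))
    (hR : ∀ i s s', G.Adj (a (i, s) + 1) (a (ρ i, s') + 1)) (v : Fin n) :
    G.Adj v (prev a ρ v) := by
  by_cases hv : ∀ x, a x + 1 ≠ v
  · rw [prev_of_notMem hv]
    have := hH (v - 1)
    rw [sub_add_cancel] at this
    exact this.symm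
  · push Not at hv
    obtain ⟨⟨i, s⟩, rfl⟩ := hv
    rw [h.prev_apply]
    exact hR i s s

theorem next_ne_prev (h : SpacedBlocks a) (hn : 3 ≤ n) (v : Fin n) : next a β v ≠ prev a ρ v := by
  by_cases hv : ∀ x, a x ≠ v
  · rw [next_of_notMem hv]
    by_cases hv' : ∀ x, a x + 1 ≠ v
    · rw [prev_of_notMem hv']
      intro he
      have h2 : (1 : Fin n) + 1 = 0 := by
        have : v + (1 + 1) = v + 0 := by rw [← add_assoc, he]; simp
        exact add_left_cancel this
      have h3 := congrArg Fin.val h2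
      rw [Fin.val_add, Fin.coe_ofNat_eq_mod, Nat.mod_eq_of_lt (show 1 < n by omega),
        Nat.mod_eq_of_lt (by omega)] at h3
      simp at h3
    · push Not at hv'
      obtain ⟨⟨i, s⟩, rfl⟩ := hv'
      rw [h.prev_apply]
      intro he
      exact h.add_one_ne _ _ (add_right_cancel he)
  · push Not at hv
    obtain ⟨⟨i, s⟩, rfl⟩ := hv
    rw [h.next_apply, prev_of_notMem fun x => h.add_one_ne _ _]
    intro he
    apply h.add_one_ne (β i, s) (i, s)
    rw [he, sub_add_cancel]

theorem label_next [Fintype I] (h : SpacedBlocks a) (v : Fin n) :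
    label a (next a β v) = label a v := by
  by_cases hv : ∀ x, a x ≠ v
  · rw [next_of_notMem hv, label_add_one_of_notMem hv]
  · push Not at hv
    obtain ⟨⟨i, s⟩, rfl⟩ := hv
    rw [h.next_apply, h.label_apply, h.label_apply]

theorem label_prev [Fintype I] (h : SpacedBlocks a) (v : Fin n) :
    label a (prev a ρ v) = label a v := by
  by_cases hv : ∀ x, a x + 1 ≠ v
  · rw [prev_of_notMem hv, ← label_add_one_of_notMem (v := v - 1), sub_add_cancel]
    exact fun x hx => hv x (by rw [hx, sub_add_cancel])
  · push Not at hv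
    obtain ⟨⟨i, s⟩, rfl⟩ := hv
    rw [h.prev_apply, h.label_add_one_of_mem, h.label_add_one_of_mem]

/-- If the blocks `i`, `β i` are completely joined, and so are the shifted blocks `i`, `ρ i`, then
a graph containing the cycle `0, 1, …, n - 1` has `2`-factors with any number of cycles up to the
block size. -/
theorem exists_two_regular [Finite I] [Nonempty I] (h : SpacedBlocks a) (ht : 2 ≤ t) (hn : 3 ≤ n)
    (hβ : ∀ i, β (β i) = i) (hρ : ∀ i, ρ (ρ i) = i) (hH : ∀ v, G.Adj v (v + 1))
    (hB : ∀ i s s', G.Adj (a (i, s)) (a (β i, s')))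
    (hR : ∀ i s s', G.Adj (a (i, s) + 1) (a (ρ i, s') + 1)) {k : ℕ} (hk : 1 ≤ k) (hkt : k ≤ t) :
    ∃ F ≤ G, (∀ v, (F.neighborSet v).ncard = 2) ∧ Nat.card F.ConnectedComponent = k := by
  classical
  have := Fintype.ofFinite I
  let F := h.ladder hβ hρ (fun v => (h.adj_next hH hB v).ne') (fun v => (h.adj_prev hH hR v).ne')
  have hFadj : ∀ u v, F.Adj u v ↔ v = next a β u ∨ v = prev a ρ u := fun u v => Iff.rfl
  -- Each block gives two classes: the block itself, paired by `β`, and its shift by one, paired by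
  -- `ρ`.
  let z : (I × Bool) × Fin t → Fin n := fun x =>
    if x.1.2 then a (x.1.1, x.2) + 1 else a (x.1.1, x.2)
  let τ : I × Bool → I × Bool := fun i => (if i.2 then ρ i.1 else β i.1, i.2)
  have hτ : ∀ i, τ (τ i) = i := by
    rintro ⟨i, b⟩
    cases b <;> simp [τ, hβ, hρ]
  have hz : Function.Injective z := by
    rintro ⟨⟨i, b⟩, s⟩ ⟨⟨j, c⟩, s'⟩ hij
    cases b <;> cases c <;> simp only [z, if_true, if_false, Bool.false_eq_true] at hij
    · have := h.injective hij
      simp_all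
    · exact absurd hij.symm (h.add_one_ne _ _)
    · exact absurd hij (h.add_one_ne _ _)
    · have := h.injective (add_right_cancel hij)
      simp_all
  have hG : ∀ i s s', G.Adj (z (i, s)) (z (τ i, s')) := by
    rintro ⟨i, b⟩ s s'
    cases b
    · simpa [z, τ] using hB i s s'
    · simpa [z, τ] using hR i s s'
  have hL : ∀ i s s', ¬ (baseGraph a).Adj (z (i, s)) (z (τ i, s')) := by
    rintro ⟨i, b⟩ s s' hadj
    rw [baseGraph, SimpleGraph.fromRel_adj] at hadj
    cases b <;> simp only [z, τ, if_true, if_false, Bool.false_eq_true] at hadj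
    · rcases hadj.2 with ⟨h', -⟩ | ⟨h', -⟩
      · exact h' _ rfl
      · exact h' _ rfl
    · rcases hadj.2 with ⟨-, h'⟩ | ⟨-, h'⟩
      · exact h.add_one_ne _ _ (add_right_cancel h').symm
      · exact h.add_one_ne _ _ (add_right_cancel h').symm
  have hF : SimpleGraph.IsLinkedFactor G (baseGraph a) τ z F := by
    refine ⟨?_, ?_, ?_, ?_⟩
    · rintro u v (rfl | rfl)
      · exact h.adj_next hH hB u
      · exact h.adj_prev hH hR u
    · intro v
      have : F.neighborSet v = {next a β v, prev a ρ v} := by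
        ext u
        simp [hFadj]
      rw [this, Set.ncard_pair (h.next_ne_prev hn v)]
    · intro u v huv
      rw [baseGraph, SimpleGraph.fromRel_adj] at huv
      rcases huv.2 with ⟨h', rfl⟩ | ⟨h', rfl⟩
      · exact Or.inl (next_of_notMem h').symm
      · exact F.adj_symm (Or.inl (next_of_notMem h').symm)
    · rintro ⟨i, b⟩ s
      refine ⟨s, ?_⟩
      rw [hFadj]
      cases b
      · left
        simp [z, τ, h.next_apply]
      · right
        simp [z, τ, h.prev_apply]
  -- The label is constant on components, and a single block already realises every residue modulo
  -- `t`.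
  have hcard : t ≤ Nat.card F.ConnectedComponent := by
    have : NeZero t := ⟨by omega⟩
    let d : F.ConnectedComponent → ZMod t := SimpleGraph.ConnectedComponent.lift (label a) (by
      intro u v p _
      induction p with
      | nil => rfl
      | cons huv p ih =>
        rw [← ih (SimpleGraph.Walk.IsPath.of_cons ‹_›)]
        rcases huv with rfl | rfl
        · exact (h.label_next _).symm
        · exact (h.label_prev _).symm)
    have hd : Function.Surjective d := by
      intro x
      obtain ⟨i⟩ := ‹Nonempty I›
      refine ⟨F.connectedComponentMk (a (i, ⟨x.val, x.val_lt⟩)), ?_⟩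
      change label a _ = x
      rw [h.label_apply]
      simp
    have := Nat.card_le_card_of_surjective d hd
    rwa [Nat.card_zmod] at this
  obtain ⟨F', hF', hk'⟩ := hF.exists_card_eq hτ hz hG hL (fun F' hF' hcon => by
    refine h.preconnected ht hF' (fun i s s' => ?_) (fun i s s' => ?_)
    · simpa [z] using hcon (i, false) s s'
    · simpa [z] using hcon (i, true) s s') hk (hkt.trans hcard)
  exact ⟨F', hF'.le, hF'.ncard_neighborSet, hk'⟩

end Ladder

end SpacedBlocks

/-! ### Complete boxes in dense sets of tuples -/

/-- If all `x ∈ s` have many neighbours in `V`, then many of them have `t` common neighbours. -/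
theorem exists_common_subset {X V : Type*} [Fintype V] (P : X → V → Prop) [∀ x y, Decidable (P x y)]
    (s : Finset X) {c : ℝ} (hc0 : 0 ≤ c) (hc : c ≤ 1)
    (h : ∀ x ∈ s, c * Fintype.card V ≤ (Finset.univ.filter (P x)).card) (t : ℕ)
    (ht : (t : ℝ) ≤ c / 2 * Fintype.card V) :
    ∃ (T : Finset V) (s' : Finset X), T.card = t ∧ s' ⊆ s ∧ (∀ x ∈ s', ∀ y ∈ T, P x y) ∧
      (c / 2) ^ t * s.card ≤ s'.card := by
  classical
  induction t with
  | zero => exact ⟨∅, s, by simp⟩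
  | succ t ih =>
    push_cast at ht
    obtain ⟨T, s', hT, hs', hP, hTs⟩ := ih (by linarith)
    have hV : (0 : ℝ) ≤ Fintype.card V := by positivity
    have hne : (Finset.univ \ T).Nonempty := by
      rw [← Finset.card_pos, Finset.card_sdiff_of_subset (Finset.subset_univ _), hT,
        Finset.card_univ, Nat.sub_pos_iff_lt]
      have : (t : ℝ) < Fintype.card V := by nlinarith
      exact_mod_cast this
    have hsum : ∑ y ∈ Finset.univ \ T, (s'.filter fun x => P x y).card =
        ∑ x ∈ s', ((Finset.univ \ T).filter (P x)).card := by
      simp only [Finset.card_filter]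
      exact Finset.sum_comm
    have hbig : ∀ x ∈ s', c / 2 * Fintype.card V ≤ (((Finset.univ \ T).filter (P x)).card : ℝ) := by
      intro x hx
      have h1 := h x (hs' hx)
      have h2 : (Finset.univ.filter (P x)).card ≤ ((Finset.univ \ T).filter (P x)).card + t := by
        rw [← hT]
        refine (Finset.card_le_card ?_).trans (Finset.card_union_le _ _)
        intro y hy
        by_cases hyT : y ∈ T <;> simp_all
      have h3 : ((Finset.univ.filter (P x)).card : ℝ) ≤
          ((Finset.univ \ T).filter (P x)).card + t := by exact_mod_cast h2
      linarith
    -- Averaging: at most `c / 2 * |V|` neighbours of each `x` are used up by `T`, so some new `y`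
    -- is joined to a proportion `c / 2` of `s'`.
    obtain ⟨y, hy, hys⟩ : ∃ y ∈ Finset.univ \ T,
        c / 2 * s'.card ≤ ((s'.filter fun x => P x y).card : ℝ) := by
      apply Finset.exists_le_of_sum_le hne
      have h4 : (∑ y ∈ Finset.univ \ T, ((s'.filter fun x => P x y).card : ℝ)) =
          ∑ x ∈ s', (((Finset.univ \ T).filter (P x)).card : ℝ) := by exact_mod_cast hsum
      rw [h4, Finset.sum_const, nsmul_eq_mul]
      refine le_trans ?_ (Finset.card_nsmul_le_sum _ _ _ hbig)
      rw [nsmul_eq_mul]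
      have : ((Finset.univ \ T).card : ℝ) ≤ Fintype.card V := by
        exact_mod_cast Finset.card_le_univ _
      have h5 : 0 ≤ c / 2 * (s'.card : ℝ) := by positivity
      nlinarith
    have hyT : y ∉ T := (Finset.mem_sdiff.1 hy).2
    refine ⟨insert y T, s'.filter fun x => P x y, by rw [Finset.card_insert_of_notMem hyT, hT],
      (Finset.filter_subset _ _).trans hs', ?_, ?_⟩
    · intro x hx
      rw [Finset.mem_filter] at hx
      exact (Finset.forall_mem_insert _ _ _).2 ⟨hx.2, hP x hx.1⟩
    · rw [pow_succ]
      have := mul_le_mul_of_nonneg_left hTs (show 0 ≤ c / 2 by linarith)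
      linarith

/-- A set containing a positive proportion of all tuples contains a large box. -/
theorem exists_box (m t : ℕ) : ∀ c : ℝ, 0 < c → c ≤ 1 → ∃ N : ℕ, ∀ n : ℕ, N ≤ n →
    ∀ S : Finset (Fin m → Fin n), c * (n : ℝ) ^ m ≤ S.card →
      ∃ A : Fin m → Finset (Fin n), (∀ i, (A i).card = t) ∧ ∀ u, (∀ i, u i ∈ A i) → u ∈ S := by
  classical
  induction m with
  | zero =>
    intro c hc _
    refine ⟨0, fun n _ S hS => ⟨fun _ => ∅, fun i => i.elim0, fun u _ => ?_⟩⟩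
    have : 0 < S.card := by
      have : (0 : ℝ) < S.card := by simp at hS; linarith
      exact_mod_cast this
    obtain ⟨v, hv⟩ := Finset.card_pos.1 this
    rwa [Subsingleton.elim u v]
  | succ m ih =>
    intro c hc hc1
    -- A proportion `c / 2` of the tails have at least `c / 2 * n` extensions in `S`. Fixing `t`
    -- common values of the first coordinate costs a further factor `(c / 4) ^ t`, and the remaining
    -- coordinates are handled by induction.
    obtain ⟨N, hN⟩ := ih ((c / 2 / 2) ^ t * (c / 2)) (by positivity)
      (mul_le_one₀ (pow_le_one₀ (by linarith) (by linarith)) (by linarith) (by linarith))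
    refine ⟨max (N + 1) ⌈4 * t / c⌉₊, fun n hn S hS => ?_⟩
    have hnN : N + 1 ≤ n := (le_max_left _ _).trans hn
    have hn0 : (0 : ℝ) < n := by exact_mod_cast (by omega : 0 < n)
    have htn : 4 * t / c ≤ n := Nat.ceil_le.1 ((le_max_right _ _).trans hn)
    let P : (Fin m → Fin n) → Fin n → Prop := fun x y => (Fin.cons y x : Fin (m + 1) → Fin n) ∈ S
    let s : Finset (Fin m → Fin n) :=
      Finset.univ.filter fun x => c / 2 * n ≤ (Finset.univ.filter (P x)).card
    have hsum : S.card = ∑ x, (Finset.univ.filter (P x)).card := by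
      have h1 : S.card = ∑ u : Fin (m + 1) → Fin n, if u ∈ S then 1 else 0 := by simp
      rw [h1, ← (Fin.consEquiv fun _ => Fin n).sum_comp, Fintype.sum_prod_type, Finset.sum_comm]
      refine Finset.sum_congr rfl fun x _ => ?_
      rw [Finset.card_filter]
      rfl
    have hscard : c / 2 * (n : ℝ) ^ m ≤ s.card := by
      have h1 : (S.card : ℝ) ≤ ∑ x : Fin m → Fin n, ((if x ∈ s then (n : ℝ) else 0) + c / 2 * n) := by
        rw [hsum]
        push_cast
        refine Finset.sum_le_sum fun x _ => ?_
        split_ifs with hx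
        · have : ((Finset.univ.filter (P x)).card : ℝ) ≤ n := by
            exact_mod_cast (Finset.card_le_univ _).trans (Fintype.card_fin n).le
          have : 0 ≤ c / 2 * n := by positivity
          linarith
        · simp only [s, Finset.mem_filter, Finset.mem_univ, true_and, not_le] at hx
          linarith
      rw [Finset.sum_add_distrib, Finset.sum_ite_mem, Finset.univ_inter, Finset.sum_const,
        Finset.sum_const, Finset.card_univ, Fintype.card_fun, Fintype.card_fin, Fintype.card_fin,
        nsmul_eq_mul, nsmul_eq_mul] at h1
      push_cast at h1
      rw [pow_succ] at hS
      have h2 : (c / 2 * (n : ℝ) ^ m) * n ≤ s.card * n := by nlinarith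
      exact le_of_mul_le_mul_right h2 hn0
    obtain ⟨T, s', hT, -, hP, hTs⟩ := exists_common_subset P s (c := c / 2) (by linarith) (by linarith)
      (by
        intro x hx
        rw [Fintype.card_fin]
        exact (Finset.mem_filter.1 hx).2) t
      (by
        rw [Fintype.card_fin]
        rw [div_le_iff₀ hc] at htn
        linarith)
    obtain ⟨A, hA, hAS⟩ := hN n (by omega) s' (by
      refine le_trans ?_ hTs
      rw [mul_assoc]
      exact mul_le_mul_of_nonneg_left hscard (by positivity))
    refine ⟨Fin.cons T A, ?_, ?_⟩
    · intro i
      refine Fin.cases ?_ (fun j => ?_) i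
      · simpa using hT
      · simpa using hA j
    · intro u hu
      have h1 := hAS (Fin.tail u) (fun i => by simpa [Fin.tail] using hu i.succ)
      have h2 := hP _ h1 (u 0) (by simpa using hu 0)
      simpa [P, Fin.cons_self_tail] using h2

theorem exists_box_prod (m t : ℕ) {c : ℝ} (hc : 0 < c) (hc1 : c ≤ 1) : ∃ N : ℕ, ∀ n : ℕ, N ≤ n →
    ∀ S : Finset ((Fin m → Fin n) × (Fin m → Fin n)), c * (n : ℝ) ^ (m + m) ≤ S.card →
      ∃ A B : Fin m → Finset (Fin n), (∀ i, (A i).card = t) ∧ (∀ i, (B i).card = t) ∧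
        ∀ u w, (∀ i, u i ∈ A i) → (∀ i, w i ∈ B i) → (u, w) ∈ S := by
  obtain ⟨N, hN⟩ := exists_box (m + m) t c hc hc1
  refine ⟨N, fun n hn S hS => ?_⟩
  obtain ⟨A, hA, hAS⟩ := hN n hn (S.map (Fin.appendEquiv m m).toEmbedding) (by
    rwa [Finset.card_map])
  refine ⟨fun i => A (Fin.castAdd m i), fun i => A (Fin.natAdd m i), fun i => hA _, fun i => hA _,
    fun u w hu hw => ?_⟩
  have := hAS (Fin.append u w) (fun i => by
    refine Fin.addCases (fun j => ?_) (fun j => ?_) i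
    · rw [Fin.append_left]
      exact hu j
    · rw [Fin.append_right]
      exact hw j)
  rw [Finset.mem_map_equiv] at this
  rwa [show Fin.append u w = Fin.appendEquiv m m (u, w) from rfl, Equiv.symm_apply_apply] at this

/-! ### Fixed neighbour patterns in a positive proportion of tuples -/

theorem card_filter_prod_le {U W : Type*} [Fintype U] [Fintype W] (Q : U → W → Prop)
    [∀ u w, Decidable (Q u w)] {C : ℝ} (h : ∀ u, ((Finset.univ.filter (Q u)).card : ℝ) ≤ C) :
    ((Finset.univ.filter fun p : U × W => Q p.1 p.2).card : ℝ) ≤ Fintype.card U * C := by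
  have : (Finset.univ.filter fun p : U × W => Q p.1 p.2).card =
      ∑ u, (Finset.univ.filter (Q u)).card := by
    simp only [Finset.card_filter]
    exact Fintype.sum_prod_type _
  rw [this]
  push_cast
  refine (Finset.sum_le_sum fun u _ => h u).trans ?_
  simp

/-- Once the first tuple is fixed, each of the `M` entries of the second has to avoid the at least
`ε * n` neighbours of one vertex. -/
theorem card_forall_not_le {n M : ℕ} {ε : ℝ} (B : Fin n → Fin n → Prop) [∀ x y, Decidable (B x y)]
    (hB : ∀ x, ε * n ≤ (Finset.univ.filter (B x)).card) (a : Fin M) :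
    ((Finset.univ.filter fun p : (Fin M → Fin n) × (Fin M → Fin n) =>
      ∀ b, ¬ B (p.1 a) (p.2 b)).card : ℝ) ≤ (1 - ε) ^ M * (n : ℝ) ^ (M + M) := by
  refine (card_filter_prod_le (fun u w : Fin M → Fin n => ∀ b, ¬ B (u a) (w b))
    (C := ((1 - ε) * n) ^ M) ?_).trans ?_
  · intro u
    have : (Finset.univ.filter fun w : Fin M → Fin n => ∀ b, ¬ B (u a) (w b)) =
        Fintype.piFinset fun _ => Finset.univ.filter fun y => ¬ B (u a) y := by
      ext w
      simp
    rw [this, Fintype.card_piFinset_const]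
    push_cast
    refine pow_le_pow_left₀ (by positivity) ?_ _
    have h1 := Finset.card_filter_add_card_filter_not (s := Finset.univ) (B (u a))
    rw [Finset.card_univ, Fintype.card_fin] at h1
    have h2 : ((Finset.univ.filter (B (u a))).card : ℝ) +
      (Finset.univ.filter fun y => ¬ B (u a) y).card = n := by exact_mod_cast h1
    have := hB (u a)
    linarith
  · rw [Fintype.card_fun, Fintype.card_fin, Fintype.card_fin, mul_pow, pow_add]
    push_cast
    exact le_of_eq (by ring)

/-- If all vertices have large degree in `B` and in `R`, then for a positive proportion
of pairs of tuples `u`, `w` there are fixed functions assigning to each entry of `u` a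
`B`-neighbour in `w` and to each entry of `w` an `R`-neighbour in `u`. -/
theorem exists_functions_of_minDegree {ε : ℝ} (hε : 0 < ε) (hε1 : ε ≤ 1) :
    ∃ M : ℕ, 0 < M ∧ ∃ c : ℝ, 0 < c ∧ c ≤ 1 ∧ ∀ (n : ℕ) (B R : Fin n → Fin n → Prop)
      [∀ x y, Decidable (B x y)] [∀ x y, Decidable (R x y)],
      (∀ x, ε * n ≤ (Finset.univ.filter (B x)).card) →
      (∀ x, ε * n ≤ (Finset.univ.filter (R x)).card) →
      ∃ f g : Fin M → Fin M, c * (n : ℝ) ^ (M + M) ≤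
        (Finset.univ.filter fun p : (Fin M → Fin n) × (Fin M → Fin n) =>
          (∀ a, B (p.1 a) (p.2 (f a))) ∧ ∀ b, R (p.2 b) (p.1 (g b))).card := by
  -- Choose `M` with `M * (1 - ε) ^ M < 1 / 4`: by the union bound each of the two requirements
  -- fails for at most a quarter of the pairs.
  have hlim := tendsto_self_mul_const_pow_of_lt_one (r := 1 - ε) (by linarith) (by linarith)
  obtain ⟨M, hM, hM0⟩ := ((hlim.eventually_lt_const (show (0 : ℝ) < 1 / 4 by norm_num)).and
    (Filter.eventually_gt_atTop 0)).exists
  have hM1 : (1 : ℝ) ≤ M := by exact_mod_cast hM0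
  have hMpos : (1 : ℝ) ≤ (M : ℝ) ^ M * (M : ℝ) ^ M :=
    one_le_mul_of_one_le_of_one_le (one_le_pow₀ hM1) (one_le_pow₀ hM1)
  -- At least half of the pairs are good, and they are shared among `M ^ M * M ^ M` choices of `(f,
  -- g)`.
  refine ⟨M, hM0, 1 / (2 * ((M : ℝ) ^ M * (M : ℝ) ^ M)), by positivity, ?_, ?_⟩
  · rw [div_le_one (by positivity)]
    linarith
  intro n B R _ _ hB hR
  have : Nonempty (Fin M) := ⟨⟨0, hM0⟩⟩
  let S : (Fin M → Fin M) × (Fin M → Fin M) → Finset ((Fin M → Fin n) × (Fin M → Fin n)) :=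
    fun q => Finset.univ.filter fun p => (∀ a, B (p.1 a) (p.2 (q.1 a))) ∧ ∀ b, R (p.2 b) (p.1 (q.2 b))
  let E : Fin M → Finset ((Fin M → Fin n) × (Fin M → Fin n)) :=
    fun a => Finset.univ.filter fun p => ∀ b, ¬ B (p.1 a) (p.2 b)
  let E' : Fin M → Finset ((Fin M → Fin n) × (Fin M → Fin n)) :=
    fun a => Finset.univ.filter fun p => ∀ b, ¬ R (p.2 a) (p.1 b)
  have hE : ∀ a, ((E a).card : ℝ) ≤ (1 - ε) ^ M * (n : ℝ) ^ (M + M) := card_forall_not_le B hB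
  have hE' : ∀ a, ((E' a).card : ℝ) ≤ (1 - ε) ^ M * (n : ℝ) ^ (M + M) := by
    intro a
    refine le_trans ?_ (card_forall_not_le R hR a)
    have : E' a = (Finset.univ.filter fun p : (Fin M → Fin n) × (Fin M → Fin n) =>
        ∀ b, ¬ R (p.1 a) (p.2 b)).map (Equiv.prodComm _ _).toEmbedding := by
      ext p
      rw [Finset.mem_map_equiv]
      simp [E']
    rw [this, Finset.card_map]
  have hcover : (Finset.univ : Finset ((Fin M → Fin n) × (Fin M → Fin n))) ⊆
      (Finset.univ.biUnion E ∪ Finset.univ.biUnion E') ∪ Finset.univ.biUnion S := by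
    intro p _
    by_cases h1 : ∀ a, ∃ b, B (p.1 a) (p.2 b)
    · by_cases h2 : ∀ a, ∃ b, R (p.2 a) (p.1 b)
      · choose f hf using h1
        choose g hg using h2
        exact Finset.mem_union_right _ (Finset.mem_biUnion.2
          ⟨(f, g), Finset.mem_univ _, Finset.mem_filter.2 ⟨Finset.mem_univ _, hf, hg⟩⟩)
      · push Not at h2
        obtain ⟨a, ha⟩ := h2
        exact Finset.mem_union_left _ (Finset.mem_union_right _ (Finset.mem_biUnion.2
          ⟨a, Finset.mem_univ _, Finset.mem_filter.2 ⟨Finset.mem_univ _, ha⟩⟩))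
    · push Not at h1
      obtain ⟨a, ha⟩ := h1
      exact Finset.mem_union_left _ (Finset.mem_union_left _ (Finset.mem_biUnion.2
        ⟨a, Finset.mem_univ _, Finset.mem_filter.2 ⟨Finset.mem_univ _, ha⟩⟩))
  have hcard : (n : ℝ) ^ (M + M) ≤ ((∑ a, (E a).card + ∑ a, (E' a).card + ∑ q, (S q).card : ℕ) : ℝ) := by
    have := (Finset.card_le_card hcover).trans ((Finset.card_union_le _ _).trans
      (Nat.add_le_add ((Finset.card_union_le _ _).trans
        (Nat.add_le_add Finset.card_biUnion_le Finset.card_biUnion_le)) Finset.card_biUnion_le))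
    rw [Finset.card_univ, Fintype.card_prod, Fintype.card_fun, Fintype.card_fin, Fintype.card_fin,
      ← pow_add] at this
    exact_mod_cast this
  push_cast at hcard
  have hEs := Finset.sum_le_sum fun a (_ : a ∈ Finset.univ) => hE a
  have hEs' := Finset.sum_le_sum fun a (_ : a ∈ Finset.univ) => hE' a
  rw [Finset.sum_const, Finset.card_univ, Fintype.card_fin, nsmul_eq_mul] at hEs hEs'
  have hpos : (0 : ℝ) ≤ (n : ℝ) ^ (M + M) := by positivity
  have hsmall : (M : ℝ) * ((1 - ε) ^ M * (n : ℝ) ^ (M + M)) ≤ 1 / 4 * (n : ℝ) ^ (M + M) := by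
    rw [← mul_assoc]
    exact mul_le_mul_of_nonneg_right hM.le hpos
  have hS : (n : ℝ) ^ (M + M) / 2 ≤ ∑ q, ((S q).card : ℝ) := by linarith
  obtain ⟨q, -, hq⟩ := Finset.exists_le_of_sum_le
    (f := fun _ => 1 / (2 * ((M : ℝ) ^ M * (M : ℝ) ^ M)) * (n : ℝ) ^ (M + M))
    (g := fun q => ((S q).card : ℝ)) Finset.univ_nonempty (by
      refine le_trans (le_of_eq ?_) hS
      rw [Finset.sum_const, Finset.card_univ, Fintype.card_prod, Fintype.card_fun, Fintype.card_fin,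
        nsmul_eq_mul]
      push_cast
      field_simp)
  exact ⟨q.1, q.2, hq⟩

/-! ### Separating and spacing the blocks -/

/-- Large subsets of a linear order contain pairwise separated subsets of prescribed size. -/
theorem exists_separated_subsets {ι V : Type*} [Fintype V] [LinearOrder V] {t : ℕ} (ht : 0 < t)
    (s : Finset ι) (A : ι → Finset V) (hA : ∀ i ∈ s, t * s.card ≤ (A i).card) :
    ∃ C : ι → Finset V, (∀ i ∈ s, C i ⊆ A i ∧ (C i).card = t) ∧
      ∀ i ∈ s, ∀ j ∈ s, i ≠ j →
        (∀ x ∈ C i, ∀ y ∈ C j, x < y) ∨ (∀ x ∈ C i, ∀ y ∈ C j, y < x) := by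
  classical
  induction hm : s.card generalizing s A with
  | zero =>
    rw [Finset.card_eq_zero] at hm
    subst hm
    exact ⟨A, by simp, by simp⟩
  | succ m ih =>
    let Z : Finset V := Finset.univ.filter fun z =>
      ∃ i ∈ s, t ≤ ((A i).filter fun x => x ≤ z).card
    have hbig : ∀ i ∈ s, t ≤ (A i).card := fun i hi =>
      (Nat.le_mul_of_pos_right t (by omega)).trans (hA i hi)
    have hZ : Z.Nonempty := by
      obtain ⟨i, hi⟩ := Finset.card_pos.1 (show 0 < s.card by omega)
      have hne : (A i).Nonempty := Finset.card_pos.1 (ht.trans_le (hbig i hi))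
      refine ⟨(A i).max' hne, Finset.mem_filter.2 ⟨Finset.mem_univ _, i, hi, ?_⟩⟩
      rw [Finset.filter_true_of_mem fun x hx => Finset.le_max' _ x hx]
      exact hbig i hi
    -- Sweep from the left to the first point `z` where some set has `t` elements. These form its
    -- block; every other set loses at most `t` elements, which the size hypothesis allows for.
    obtain ⟨z, hz, hmin⟩ := Finset.exists_min_image Z id hZ
    obtain ⟨i, hi, hiz⟩ := (Finset.mem_filter.1 hz).2
    obtain ⟨D, hD, hDcard⟩ := Finset.exists_subset_card_eq hiz
    have hfew : ∀ j ∈ s, ((A j).filter fun x => x ≤ z).card ≤ t := by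
      intro j hj
      have hlt : ((A j).filter fun x => x < z).card < t := by
        by_contra hcon
        push Not at hcon
        have hne := Finset.card_pos.1 (ht.trans_le hcon)
        have hmem := Finset.mem_filter.1 (Finset.max'_mem _ hne)
        refine absurd (hmin (((A j).filter fun x => x < z).max' hne)
          (Finset.mem_filter.2 ⟨Finset.mem_univ _, j, hj, hcon.trans (Finset.card_le_card ?_)⟩))
          (not_le.2 hmem.2)
        intro x hx
        exact Finset.mem_filter.2 ⟨(Finset.mem_filter.1 hx).1, Finset.le_max' _ x hx⟩
      have : ((A j).filter fun x => x ≤ z) ⊆ insert z ((A j).filter fun x => x < z) := by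
        intro x hx
        rw [Finset.mem_filter] at hx
        rcases hx.2.eq_or_lt with h | h
        · exact Finset.mem_insert.2 (Or.inl h)
        · exact Finset.mem_insert_of_mem (Finset.mem_filter.2 ⟨hx.1, h⟩)
      have := (Finset.card_le_card this).trans (Finset.card_insert_le _ _)
      omega
    have hcard : (s.erase i).card = m := by rw [Finset.card_erase_of_mem hi]; omega
    obtain ⟨C, hC, hCsep⟩ := ih (s.erase i) (fun j => (A j).filter fun x => ¬ x ≤ z) (by
      intro j hj
      have hj := Finset.mem_of_mem_erase hj
      have h1 := hfew j hj
      have h2 := hA j hj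
      have h3 := Finset.card_filter_add_card_filter_not (s := A j) (fun x => x ≤ z)
      rw [hcard]
      rw [hm, Nat.mul_succ] at h2
      omega) hcard
    have hlt : ∀ j ∈ s, j ≠ i → ∀ x ∈ D, ∀ y ∈ C j, x < y := by
      intro j hj hji x hx y hy
      have hx := (Finset.mem_filter.1 (hD hx)).2
      have hy := (Finset.mem_filter.1 ((hC j (Finset.mem_erase.2 ⟨hji, hj⟩)).1 hy)).2
      exact hx.trans_lt (not_le.1 hy)
    refine ⟨Function.update C i D, ?_, ?_⟩
    · intro j hj
      by_cases hji : j = i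
      · subst hji
        rw [Function.update_self]
        exact ⟨hD.trans (Finset.filter_subset _ _), hDcard⟩
      · rw [Function.update_of_ne hji]
        have := hC j (Finset.mem_erase.2 ⟨hji, hj⟩)
        exact ⟨this.1.trans (Finset.filter_subset _ _), this.2⟩
    · intro j hj l hl hjl
      by_cases hji : j = i
      · subst hji
        rw [Function.update_self, Function.update_of_ne hjl.symm]
        exact Or.inl (hlt l hl hjl.symm)
      · by_cases hli : l = i
        · subst hli
          rw [Function.update_self, Function.update_of_ne hji]
          exact Or.inr fun x hx y hy => hlt j hj hji y hy x hx
        · rw [Function.update_of_ne hji, Function.update_of_ne hli]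
          exact hCsep j (Finset.mem_erase.2 ⟨hji, hj⟩) l (Finset.mem_erase.2 ⟨hli, hl⟩) hjl

/-- Taking every second element of large pairwise separated sets gives spaced blocks. -/
theorem exists_spacedBlocks {ι : Type*} {t n : ℕ} (C : ι → Finset (Fin n))
    (hC : ∀ i, (C i).card = 2 * t)
    (hsep : ∀ i j, i ≠ j → (∀ x ∈ C i, ∀ y ∈ C j, x < y) ∨ (∀ x ∈ C i, ∀ y ∈ C j, y < x)) :
    ∃ a : ι × Fin t → Fin n, SpacedBlocks a ∧ ∀ i s, a (i, s) ∈ C i := by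
  let a : ι × Fin t → Fin n := fun x =>
    (C x.1).orderEmbOfFin (hC x.1) ⟨2 * x.2.val, by omega⟩
  -- The odd-indexed elements are buffers: `b x` lies strictly between `a x` and any later block
  -- vertex, and also keeps `a x` off the last vertex.
  let b : ι × Fin t → Fin n := fun x =>
    (C x.1).orderEmbOfFin (hC x.1) ⟨2 * x.2.val + 1, by omega⟩
  have ha : ∀ x, a x ∈ C x.1 := fun x => Finset.orderEmbOfFin_mem _ _ _
  have hb : ∀ x, b x ∈ C x.1 := fun x => Finset.orderEmbOfFin_mem _ _ _
  have hab : ∀ x, a x < b x := fun x =>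
    ((C x.1).orderEmbOfFin (hC x.1)).strictMono (by simp [Fin.lt_def])
  have hmono : ∀ i, StrictMono fun s => a (i, s) := by
    intro i s s' h
    exact ((C i).orderEmbOfFin (hC i)).strictMono (by rw [Fin.lt_def] at h ⊢; simpa using h)
  have hba : ∀ x y, a x < a y → b x < a y := by
    rintro ⟨i, s⟩ ⟨j, s'⟩ h
    by_cases hij : i = j
    · subst hij
      rw [(hmono i).lt_iff_lt, Fin.lt_def] at h
      exact ((C i).orderEmbOfFin (hC i)).strictMono (by rw [Fin.lt_def]; simp only; omega)
    · rcases hsep i j hij with h' | h'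
      · exact h' _ (hb _) _ (ha _)
      · exact absurd h (h' _ (ha (i, s)) _ (ha (j, s'))).asymm
  refine ⟨a, ⟨hmono, ?_, ?_, ?_⟩, fun i s => ha (i, s)⟩
  · intro i j hij
    exact (hsep i j hij).imp (fun h s s' => h _ (ha (i, s)) _ (ha (j, s')))
      (fun h s s' => h _ (ha (i, s)) _ (ha (j, s')))
  · intro x y h
    have h1 := hab x
    have h2 := hba x y h
    rw [Fin.lt_def] at h1 h2
    omega
  · intro x
    have h1 := hab x
    rw [Fin.lt_def] at h1
    omega

/-! ### Assembling the block system -/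

theorem SpacedBlocks.comp {I I' : Type*} {t n : ℕ} {a : I × Fin t → Fin n} (h : SpacedBlocks a)
    {e : I' → I} (he : Function.Injective e) : SpacedBlocks fun x : I' × Fin t => a (e x.1, x.2) where
  strictMono i := h.strictMono (e i)
  separated i j hij := h.separated (e i) (e j) (he.ne hij)
  spaced x y := h.spaced (e x.1, x.2) (e y.1, y.2)
  lt_last x := h.lt_last (e x.1, x.2)

theorem Function.periodicPts_nonempty {α : Type*} [Finite α] [Nonempty α] (h : α → α) :
    (Function.periodicPts h).Nonempty := by
  obtain ⟨x⟩ := ‹Nonempty α›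
  obtain ⟨m, m', hne, heq⟩ := Finite.exists_ne_map_eq_of_infinite fun m : ℕ => h^[m] x
  wlog hlt : m < m' generalizing m m'
  · exact this m' m hne.symm heq.symm (by omega)
  refine ⟨h^[m] x, Function.mk_mem_periodicPts (n := m' - m) (by omega) ?_⟩
  change h^[m' - m] (h^[m] x) = h^[m] x
  rw [← Function.iterate_add_apply, Nat.sub_add_cancel hlt.le]
  exact heq.symm

/-- A graph on `Fin n` of large minimum degree containing the cycle `0, 1, …, n - 1` has
`2`-factors with `k` cycles. -/
theorem exists_two_regular_of_minDegree (k : ℕ) (hk : 1 ≤ k) {ε : ℝ} (hε : 0 < ε) (hε1 : ε ≤ 1) :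
    ∃ N : ℕ, ∀ (n : ℕ) [NeZero n] (G : SimpleGraph (Fin n)) [DecidableRel G.Adj], N ≤ n →
      (∀ v, G.Adj v (v + 1)) → (∀ v, ε * n ≤ G.degree v) →
      ∃ F ≤ G, (∀ v, (F.neighborSet v).ncard = 2) ∧ Nat.card F.ConnectedComponent = k := by
  classical
  obtain ⟨M, hM, c, hc, hc1, hfun⟩ := exists_functions_of_minDegree hε hε1
  -- Connectivity needs two elements in every block.
  set t := max k 2 with ht
  have ht2 : 2 ≤ t := le_max_right _ _
  -- Spacing out a block uses `2 * t` elements, and separating the `M + M` blocks multiplies this by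
  -- their number.
  obtain ⟨N, hN⟩ := exists_box_prod M (2 * t * (M + M)) hc hc1
  refine ⟨max N 3, fun n _ G _ hn hH hdeg => ?_⟩
  obtain ⟨f, g, hfg⟩ := hfun n G.Adj (fun u v => G.Adj (u + 1) (v + 1))
    (by
      intro x
      rw [← G.neighborFinset_eq_filter]
      exact hdeg x)
    (by
      intro x
      refine (hdeg (x + 1)).trans (le_of_eq ?_)
      rw [← G.card_neighborFinset_eq_degree, G.neighborFinset_eq_filter,
        ← Finset.card_map (Equiv.addRight (1 : Fin n)).symm.toEmbedding]
      congr 2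
      ext v
      rw [Finset.mem_map_equiv]
      simp)
  obtain ⟨A, B, hA, hB, hAB⟩ := hN n ((le_max_left _ _).trans hn) _ hfg
  obtain ⟨C, hC, hsep⟩ := exists_separated_subsets (t := 2 * t) (by omega)
    (Finset.univ : Finset (Fin M ⊕ Fin M)) (Sum.elim A B) (by
      rintro (i | i) -
      · simp [hA]
      · simp [hB])
  obtain ⟨a, ha, haC⟩ := exists_spacedBlocks C (fun i => (hC i (Finset.mem_univ _)).2)
    (fun i j hij => hsep i (Finset.mem_univ _) j (Finset.mem_univ _) hij)
  have haA : ∀ i s, a (Sum.inl i, s) ∈ A i := fun i s =>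
    (hC (Sum.inl i) (Finset.mem_univ _)).1 (haC _ s)
  have haB : ∀ i s, a (Sum.inr i, s) ∈ B i := fun i s =>
    (hC (Sum.inr i) (Finset.mem_univ _)).1 (haC _ s)
  have hmem : ∀ s s' : Fin t, (∀ i, G.Adj (a (Sum.inl i, s)) (a (Sum.inr (f i), s'))) ∧
      ∀ i, G.Adj (a (Sum.inr i, s') + 1) (a (Sum.inl (g i), s) + 1) := by
    intro s s'
    exact (Finset.mem_filter.1 (hAB (fun i => a (Sum.inl i, s)) (fun i => a (Sum.inr i, s'))
      (fun i => haA i s) (fun i => haB i s'))).2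
  have : Nonempty (Fin M) := ⟨⟨0, hM⟩⟩
  -- On its periodic points `g ∘ f` is a permutation `σ`, so `f` is injective there. Keep only the
  -- blocks `A j` and `B (f j)` with `j ∈ J`: `β` pairs `A j` with `B (f j)`, and `ρ` pairs `B (f
  -- j)` with `A (σ j)`.
  let J := Function.periodicPts (g ∘ f)
  have hJ : Nonempty J := (Function.periodicPts_nonempty (g ∘ f)).to_subtype
  let σ : J ≃ J := (Function.bijOn_periodicPts (g ∘ f)).equiv
  have hσ : ∀ j : J, g (f j) = (σ j : Fin M) := fun j => rfl
  have hσ' : ∀ j : J, g (f (σ.symm j)) = (j : Fin M) := fun j => by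
    rw [hσ, Equiv.apply_symm_apply]
  let e : J ⊕ J → Fin M ⊕ Fin M := Sum.map Subtype.val fun j => f j
  have he : Function.Injective e := by
    refine Function.Injective.sumMap Subtype.val_injective fun i j hij => σ.injective ?_
    apply Subtype.ext
    rw [← hσ, ← hσ]
    exact congrArg g hij
  refine (ha.comp he).exists_two_regular (β := Sum.swap)
    (ρ := Sum.elim (fun j => Sum.inr (σ.symm j)) fun j => Sum.inl (σ j)) ht2
    ((le_max_right _ _).trans hn) (by simp) ?_ hH ?_ ?_ hk (le_max_left _ _)
  · rintro (i | i) <;> simp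
  · rintro (i | i) s s'
    · exact (hmem s s').1 i
    · exact ((hmem s' s).1 i).symm
  · rintro (i | i) s s'
    · have := ((hmem s s').2 (f (σ.symm i))).symm
      rw [hσ'] at this
      exact this
    · exact (hmem s' s).2 (f i)

/-! ### From Hamiltonian graphs to the threshold -/

/-- The vertices of a Hamiltonian graph can be numbered along a Hamiltonian cycle. -/
theorem SimpleGraph.IsHamiltonian.exists_equiv {V : Type*} [Fintype V] [DecidableEq V]
    {G : SimpleGraph V} (hG : G.IsHamiltonian) (hcard : Fintype.card V ≠ 1)
    [NeZero (Fintype.card V)] :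
    ∃ e : Fin (Fintype.card V) ≃ V, ∀ i, G.Adj (e i) (e (i + 1)) := by
  obtain ⟨v, p, hp⟩ := hG hcard
  have hlen : p.length = Fintype.card V := hp.length_eq
  have hinj : Function.Injective fun i : Fin (Fintype.card V) => p.getVert i := by
    intro i j hij
    refine Fin.ext (hp.isCycle.getVert_injOn' ?_ ?_ hij)
    · simp only [Set.mem_ofPred_eq]
      omega
    · simp only [Set.mem_ofPred_eq]
      omega
  refine ⟨Equiv.ofBijective _ ((Fintype.bijective_iff_injective_and_card _).2
    ⟨hinj, Fintype.card_fin _⟩), fun i => ?_⟩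
  simp only [Equiv.ofBijective_apply]
  have hadj := p.adj_getVert_succ (i := i) (by omega)
  by_cases hi : i.val + 1 < Fintype.card V
  · rwa [Fin.val_add_one_of_val_lt hi]
  · rw [Fin.add_one_eq_zero_of_val hi]
    rw [show i.val + 1 = p.length by omega, p.getVert_length] at hadj
    simpa using hadj

theorem exists_hasTwoFactorWithCycles (k : ℕ) (hk : 1 ≤ k) {ε : ℝ} (hε : 0 < ε) :
    ∃ N : ℕ, ∀ (V : Type*) [Fintype V] [DecidableEq V] (G : SimpleGraph V) [DecidableRel G.Adj],
      N ≤ Fintype.card V → G.IsHamiltonian → ε * (Fintype.card V : ℝ) ≤ (G.minDegree : ℝ) →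
        G.HasTwoFactorWithCycles k := by
  classical
  obtain ⟨N, hN⟩ := exists_two_regular_of_minDegree k hk (ε := min ε 1) (by positivity)
    (min_le_right _ _)
  -- At least two vertices are required because the one-vertex graph is Hamiltonian by convention
  -- without having a cycle.
  refine ⟨max N 2, fun V _ _ G _ hn hG hdeg => ?_⟩
  have h2 : 2 ≤ Fintype.card V := (le_max_right _ _).trans hn
  have : NeZero (Fintype.card V) := ⟨by omega⟩
  obtain ⟨e, he⟩ := hG.exists_equiv (by omega)
  obtain ⟨F, hFG, hF2, hFk⟩ := hN _ (G.comap e) ((le_max_left _ _).trans hn) he (fun v => by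
    have h1 : (G.comap e).degree v = G.degree (e v) := ((SimpleGraph.Iso.comap e G).degree_eq v).symm
    rw [h1]
    refine le_trans ?_ (hdeg.trans (by exact_mod_cast G.minDegree_le_degree (e v)))
    exact mul_le_mul_of_nonneg_right (min_le_left _ _) (by positivity))
  exact SimpleGraph.HasTwoFactorWithCycles.of_iso_card e (fun u v h => hFG h) hF2 hFk

theorem theorem2 :
    (∀ k : ℕ, 1 ≤ k → ∀ ε : ℝ, 0 < ε → ∃ N : ℕ,
      ∀ (V : Type*) [Fintype V] [DecidableEq V] (G : SimpleGraph V) [DecidableRel G.Adj],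
        N ≤ Fintype.card V → G.IsHamiltonian → ε * (Fintype.card V : ℝ) ≤ (G.minDegree : ℝ) →
          G.HasTwoFactorWithCycles k) ∧
    (∀ k : ℕ, 1 ≤ k →
      (fun n : ℕ => (twoFactorThreshold k n : ℝ)) =o[Filter.atTop] (fun n : ℕ => (n : ℝ))) := by
  refine ⟨fun k hk ε hε => exists_hasTwoFactorWithCycles k hk hε, fun k hk => ?_⟩
  rw [Asymptotics.isLittleO_iff]
  intro c hc
  -- Half of `c` leaves room for rounding the degree bound up to an integer: the extra `1` is at
  -- most `c / 2 * n` once `n ≥ 2 / c`.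
  obtain ⟨N, hN⟩ := exists_hasTwoFactorWithCycles k hk (ε := c / 2) (by positivity)
  filter_upwards [Filter.eventually_ge_atTop (max N ⌈2 / c⌉₊)] with n hn
  have hnc : 2 / c ≤ n := Nat.ceil_le.1 ((le_max_right _ _).trans hn)
  have hle : twoFactorThreshold k n ≤ ⌈c / 2 * n⌉₊ := by
    refine Nat.sInf_le fun G _ hG hdeg => ?_
    refine hN (Fin n) G (by rw [Fintype.card_fin]; exact (le_max_left _ _).trans hn) hG ?_
    rw [Fintype.card_fin]
    exact Nat.ceil_le.1 hdeg
  have h1 : (twoFactorThreshold k n : ℝ) ≤ c / 2 * n + 1 :=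
    (Nat.cast_le.2 hle).trans (Nat.ceil_lt_add_one (by positivity)).le
  rw [div_le_iff₀ hc] at hnc
  rw [Real.norm_natCast, Real.norm_natCast]
  linarith
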